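/- Let $m\ge 0$ and let $S$ be a positive definite even integral symmetric matrix of degree $m$ (integral, symmetric, with even diagonal entries). Write $S(x,y)={}^t x S y$ and $S[x]=S(x,x)$. On $V=\mathbb R^{m+4}$ consider the symmetric bilinear form $Q(x,y)={}^t x Q y$ and the quadratic form $q(x)=\tfrac12 Q(x,x)$, where $$Q=\begin{pmatrix} & & J\\ & -S & \\ J & & \end{pmatrix},\qquad J=\begin{pmatrix}0&1\\1&0\end{pmatrix}.$$ Let $L=\mathbb Z^{m+4}$ and $L^*=Q^{-1}L$. Let $\mathfrak H$ be the upper half plane. For $\tau\in\mathfrak H$, $\alpha\in L^*/L$ and a two-dimensional subspace $v\subset V$ on which $q$ is positive definite, let $$\Theta_\alpha(\tau,v)=\sum_{\lambda\in\alpha+L}\exp\bigl(2\pi i\,(\tau q(\lambda_v)+\bar\tau q(\lambda_v^{\perp}))\bigr),$$ where $\lambda_v$ and $\lambda_v^\perp$ are the projections of $\lambda$ to $v$ and to its orthogonal complement with respect to $Q$. Let $$\mathcal D=\{Z=(z,w,z')\in\mathfrak H\times\mathbb C^m\times\mathfrak H : 2\,\mathrm{Im}(z)\,\mathrm{Im}(z')-S[\mathrm{Im}(w)]>0\}.$$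 For $Z\in\mathcal D$ put $\Theta_\alpha(\tau,Z)=\Theta_\alpha(\tau,v_Z)$, where $v_Z$ is the span of the real and imaginary parts of $\widetilde Z={}^t\bigl(-zz'+\tfrac12S[w],\,z,\,w,\,z',\,1\bigr)$ (with $S[w]={}^twSw$). **Theorem.** Let $\alpha\in L^*/L$ and $\tau\in\mathfrak H$. The series defining $\Theta_\alpha(\tau,Z)$ converges absolutely for every $Z\in\mathcal D$, and $Z\mapsto\Theta_\alpha(\tau,Z)$ satisfies the additive symmetry. That is, for every integer $n\ge1$ and every $(z,w,z')\in\mathcal D$, $$\sum_{(a,b,d)\in\mathcal H_n}\Theta_\alpha\Bigl(\tau,\Bigl(\frac{az+b}{d},\frac{\sqrt n}{d}w,z'\Bigr)\Bigr)=\sum_{(a,b,d)\in\mathcal H_n}\Theta_\alpha\Bigl(\tau,\Bigl(z,\frac{\sqrt n}{d}w,\frac{az'+b}{d}\Bigr)\Bigr),$$ where $\mathcal H_n=\{(a,b,d)\in\mathbb Z^3 : a,d>0,\ ad=n,\ 0\le b<d\}$. -/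

import Mathlib

open scoped UpperHalfPlane Matrix

noncomputable section

namespace SiegelTheta

/-- A positive definite even integral symmetric matrix of degree `m`; `m = 0` is allowed. -/
structure EvenPosDefMatrix (m : ℕ) where
  mat : Matrix (Fin m) (Fin m) ℤ
  even_diag : ∀ i, Even (mat i i)
  posDef : (mat.map (Int.cast : ℤ → ℝ)).PosDef

/-- Index set of the coordinates `(x₁, x₂ | x₀ | x₃, x₄)` of an `(m + 4)`-dimensional space, in
blocks of sizes `2`, `m` and `2`. -/
abbrev Idx (m : ℕ) : Type := Fin 2 ⊕ (Fin m ⊕ Fin 2)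

/-- The real quadratic space `V = ℝ^{m+4}`. -/
abbrev V (m : ℕ) : Type := Idx m → ℝ

variable {m : ℕ} (S : EvenPosDefMatrix m)

/-- The form `S(x, y) = ᵗx S y` on `ℝ^m`. -/
def sForm : LinearMap.BilinForm ℝ (Fin m → ℝ) :=
  Matrix.toBilin' (S.mat.map (Int.cast : ℤ → ℝ))

/-- The form `S(x, y) = ᵗx S y` on `ℂ^m`, complex bilinear. -/
def sFormC : LinearMap.BilinForm ℂ (Fin m → ℂ) :=
  Matrix.toBilin' (S.mat.map (Int.cast : ℤ → ℂ))

/-- The integral matrix `Q`, with `J` on the antidiagonal blocks and `-S` in the middle, where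
`J` is the antidiagonal unit matrix of degree two. -/
def matQ : Matrix (Idx m) (Idx m) ℤ :=
  Matrix.fromBlocks 0 (Matrix.fromCols 0 !![0, 1; 1, 0])
    (Matrix.fromRows 0 !![0, 1; 1, 0]) (Matrix.fromBlocks (-S.mat) 0 0 0)

/-- The bilinear form `Q(x, y) = ᵗx Q y` on `V`. -/
def Q : LinearMap.BilinForm ℝ (V m) :=
  Matrix.toBilin' ((matQ S).map (Int.cast : ℤ → ℝ))

/-- The quadratic form `q(x) = Q(x, x) / 2` on `V`. -/
def q (x : V m) : ℝ := Q S x x / 2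

/-! ### The lattice, its dual and the discriminant group -/

/-- The lattice `L = ℤ^{m+4}` in `V`. -/
def lattice (m : ℕ) : AddSubgroup (V m) where
  carrier := {x | ∀ i, ∃ k : ℤ, x i = k}
  zero_mem' := fun _ => ⟨0, by simp⟩
  add_mem' := by
    intro x y hx hy i
    obtain ⟨k, hk⟩ := hx i
    obtain ⟨l, hl⟩ := hy i
    exact ⟨k + l, by simp [hk, hl]⟩
  neg_mem' := by
    intro x hx i
    obtain ⟨k, hk⟩ := hx i
    exact ⟨-k, by simp [hk]⟩

/-- The dual lattice `L* = Q⁻¹ L`, i.e. the set of all `x ∈ V` with `Q x ∈ L`. -/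
def dualLattice : AddSubgroup (V m) :=
  (lattice m).comap
    (Matrix.mulVecLin ((matQ S).map (Int.cast : ℤ → ℝ))).toAddMonoidHom

/-- The quotient group `L* / L`. -/
abbrev DiscGroup : Type :=
  dualLattice S ⧸ (lattice m).addSubgroupOf (dualLattice S)

/-- The coset `α + L`, as a set of vectors of `L*`. -/
def cosetSet (α : DiscGroup S) : Set (dualLattice S) :=
  {l | (QuotientAddGroup.mk l : DiscGroup S) = α}

/-! ### The Grassmannian and the Siegel theta function -/

/-- The Grassmannian of two-dimensional subspaces of `V` on which `q` is positive definite. -/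
structure Gr where
  space : Submodule ℝ (V m)
  finrank_eq : Module.finrank ℝ space = 2
  pos : ∀ x ∈ space, x ≠ 0 → 0 < q S x

variable {S}

lemma mat_symm (i j : Fin m) : S.mat i j = S.mat j i := by
  have h := S.posDef.isHermitian.apply j i
  simpa using h

lemma sForm_symm (x y : Fin m → ℝ) : sForm S x y = sForm S y x := by
  simp only [sForm, Matrix.toBilin'_apply]
  rw [Finset.sum_comm]
  refine Finset.sum_congr rfl fun i _ => Finset.sum_congr rfl fun j _ => ?_
  simp only [Matrix.map_apply]
  rw [mat_symm j i]
  ring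

lemma Q_apply (x y : V m) :
    Q S x y = x (.inl 0) * y (.inr (.inr 1)) + x (.inl 1) * y (.inr (.inr 0))
      - sForm S (fun i => x (.inr (.inl i))) (fun i => y (.inr (.inl i)))
      + x (.inr (.inr 0)) * y (.inl 1) + x (.inr (.inr 1)) * y (.inl 0) := by
  simp only [Q, sForm, matQ, Matrix.toBilin'_apply, Fintype.sum_sum_type, Fin.sum_univ_two]
  simp [Finset.sum_neg_distrib]
  ring

lemma Q_isRefl : (Q S).IsRefl := by
  intro x y h
  rw [Q_apply] at h ⊢
  rw [sForm_symm]
  linarith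

/-- `V` is the direct sum of `v` and its orthogonal complement with respect to `Q`. -/
lemma Gr.isCompl (v : Gr S) : IsCompl v.space ((Q S).orthogonal v.space) := by
  rw [LinearMap.BilinForm.isCompl_orthogonal_iff_disjoint Q_isRefl, Submodule.disjoint_def]
  intro x hx hx'
  by_contra h0
  have h1 := v.pos x hx h0
  have h2 : Q S x x = 0 := hx' x hx
  simp [q, h2] at h1

/-- The projection `l_v` of `l ∈ V` to `v`, along the orthogonal complement of `v`. -/
def Gr.proj (v : Gr S) (l : V m) : V m :=
  v.space.projection ((Q S).orthogonal v.space) v.isCompl l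

/-- The projection of `l ∈ V` to the orthogonal complement of `v`, along `v`. -/
def Gr.projPerp (v : Gr S) (l : V m) : V m :=
  ((Q S).orthogonal v.space).projection v.space v.isCompl.symm l

/-- The term `exp(2πi (τ q(l_v) + τ̄ q(l_{v^⊥})))` of the Siegel theta series. -/
def thetaTerm (τ : ℍ) (v : Gr S) (l : V m) : ℂ :=
  Complex.exp (2 * Real.pi * Complex.I *
    ((τ : ℂ) * (q S (v.proj l) : ℂ)
      + (starRingEnd ℂ) (τ : ℂ) * (q S (v.projPerp l) : ℂ)))

/-- The Siegel theta function `Θ_α(τ, v)` on the upper half plane times the Grassmannian. -/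
def theta (α : DiscGroup S) (τ : ℍ) (v : Gr S) : ℂ :=
  ∑' l : cosetSet S α, thetaTerm τ v (l : V m)

/-! ### The tube domain -/

variable (S)

/-- The tube domain `𝒟` of all `(z, w, z')` in `ℍ × ℂ^m × ℍ` such that
`2 Im(z) Im(z') - S[Im(w)] > 0`. -/
@[ext]
structure TubeDomain where
  z : ℍ
  w : Fin m → ℂ
  z' : ℍ
  pos : 0 < 2 * z.im * z'.im - sForm S (fun i => (w i).im) (fun i => (w i).im)

variable {S}

/-- The vector `Z̃ = (-Q₁[Z]/2, Z, 1)` of `V ⊗ ℂ`, where `Q₁[Z] = 2 z z' - S[w]`. -/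
def TubeDomain.tilde (Z : TubeDomain S) : Idx m → ℂ :=
  Sum.elim ![-(2 * (Z.z : ℂ) * (Z.z' : ℂ) - sFormC S Z.w Z.w) / 2, (Z.z : ℂ)]
    (Sum.elim Z.w ![(Z.z' : ℂ), 1])

/-- The real part of `Z̃`. -/
def TubeDomain.reTilde (Z : TubeDomain S) : V m := fun i => (Z.tilde i).re

/-- The imaginary part of `Z̃`. -/
def TubeDomain.imTilde (Z : TubeDomain S) : V m := fun i => (Z.tilde i).im

lemma sFormC_re (w : Fin m → ℂ) :
    (sFormC S w w).re = sForm S (fun i => (w i).re) (fun i => (w i).re)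
      - sForm S (fun i => (w i).im) (fun i => (w i).im) := by
  simp only [sFormC, sForm, Matrix.toBilin'_apply, Complex.re_sum, ← Finset.sum_sub_distrib]
  refine Finset.sum_congr rfl fun i _ => Finset.sum_congr rfl fun j _ => ?_
  simp

lemma sFormC_im (w : Fin m → ℂ) :
    (sFormC S w w).im = sForm S (fun i => (w i).re) (fun i => (w i).im)
      + sForm S (fun i => (w i).im) (fun i => (w i).re) := by
  simp only [sFormC, sForm, Matrix.toBilin'_apply, Complex.im_sum, ← Finset.sum_add_distrib]
  refine Finset.sum_congr rfl fun i _ => Finset.sum_congr rfl fun j _ => ?_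
  simp

lemma Q_re_re (Z : TubeDomain S) : Q S Z.reTilde Z.reTilde =
    2 * Z.z.im * Z.z'.im - sForm S (fun i => (Z.w i).im) (fun i => (Z.w i).im) := by
  have h := sFormC_re (S := S) Z.w
  rw [Q_apply]
  simp [TubeDomain.reTilde, TubeDomain.tilde, h]
  ring

lemma Q_im_im (Z : TubeDomain S) : Q S Z.imTilde Z.imTilde =
    2 * Z.z.im * Z.z'.im - sForm S (fun i => (Z.w i).im) (fun i => (Z.w i).im) := by
  rw [Q_apply]
  simp [TubeDomain.imTilde, TubeDomain.tilde]
  ring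

lemma Q_re_im (Z : TubeDomain S) : Q S Z.reTilde Z.imTilde = 0 := by
  have h := sFormC_im (S := S) Z.w
  have hs := sForm_symm (S := S) (fun i => (Z.w i).im) (fun i => (Z.w i).re)
  rw [Q_apply]
  simp [TubeDomain.reTilde, TubeDomain.imTilde, TubeDomain.tilde, h, hs]
  ring

lemma q_comb (Z : TubeDomain S) (a b : ℝ) : q S (a • Z.reTilde + b • Z.imTilde) =
    (a ^ 2 + b ^ 2) *
      (2 * Z.z.im * Z.z'.im - sForm S (fun i => (Z.w i).im) (fun i => (Z.w i).im)) / 2 := by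
  have h : Q S Z.imTilde Z.reTilde = 0 := Q_isRefl _ _ (Q_re_im Z)
  simp only [q, map_add, map_smul, LinearMap.add_apply, LinearMap.smul_apply, smul_eq_mul,
    Q_re_re, Q_im_im, Q_re_im, h]
  ring

lemma comb_eq_zero (Z : TubeDomain S) (a b : ℝ) (h : a • Z.reTilde + b • Z.imTilde = 0) :
    a = 0 ∧ b = 0 := by
  have h1 := q_comb Z a b
  rw [h] at h1
  have h2 : (a ^ 2 + b ^ 2) *
      (2 * Z.z.im * Z.z'.im - sForm S (fun i => (Z.w i).im) (fun i => (Z.w i).im)) = 0 := by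
    simp only [q, map_zero, zero_div] at h1
    linarith
  rcases mul_eq_zero.1 h2 with h3 | h3
  · constructor <;> nlinarith [sq_nonneg a, sq_nonneg b]
  · exact absurd h3 Z.pos.ne'

/-- The point `v_Z` of the Grassmannian: the subspace spanned by the real and imaginary parts of
`Z̃`. -/
def TubeDomain.toGr (Z : TubeDomain S) : Gr S where
  space := Submodule.span ℝ {Z.reTilde, Z.imTilde}
  finrank_eq := by
    have hli : LinearIndependent ℝ ![Z.reTilde, Z.imTilde] :=
      LinearIndependent.pair_iff.2 fun a b h => comb_eq_zero Z a b h
    have h := finrank_span_eq_card hli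
    rw [Matrix.range_cons_cons_empty] at h
    simpa using h
  pos := by
    intro x hx hx0
    obtain ⟨a, b, rfl⟩ := Submodule.mem_span_pair.1 hx
    rw [q_comb]
    have hab : 0 < a ^ 2 + b ^ 2 := by
      by_contra hcon
      have ha : a = 0 := by nlinarith [sq_nonneg a, sq_nonneg b]
      have hb : b = 0 := by nlinarith [sq_nonneg a, sq_nonneg b]
      exact hx0 (by simp [ha, hb])
    have := mul_pos hab Z.pos
    linarith

/-- `Θ_α(τ, Z) = Θ_α(τ, v_Z)` for `Z` in the tube domain. -/
def thetaTube (α : DiscGroup S) (τ : ℍ) (Z : TubeDomain S) : ℂ := theta α τ Z.toGr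

/-! ### The Hecke sets and the two families of translates -/

/-- The finite set of all `(a, b, d) ∈ ℤ³` with `a, d > 0`, `a d = n` and `0 ≤ b < d`. -/
def heckeSet (n : ℕ) : Finset (ℤ × ℤ × ℤ) :=
  (Finset.Icc 1 (n : ℤ) ×ˢ Finset.Ico 0 (n : ℤ) ×ˢ Finset.Icc 1 (n : ℤ)).filter
    fun t => t.1 * t.2.2 = n ∧ t.2.1 < t.2.2

lemma mem_heckeSet {n : ℕ} {a b d : ℤ} :
    (a, b, d) ∈ heckeSet n ↔ (0 < a ∧ 0 < d) ∧ a * d = n ∧ 0 ≤ b ∧ b < d := by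
  simp only [heckeSet, Finset.mem_filter, Finset.mem_product, Finset.mem_Icc, Finset.mem_Ico]
  constructor
  · rintro ⟨⟨⟨h1, h2⟩, ⟨h3, h4⟩, h5, h6⟩, h7, h8⟩
    exact ⟨⟨by omega, by omega⟩, h7, h3, h8⟩
  · rintro ⟨⟨h1, h2⟩, h3, h4, h5⟩
    have ha : a ≤ n := by nlinarith
    have hd : d ≤ n := by nlinarith
    exact ⟨⟨⟨by omega, ha⟩, ⟨h4, by omega⟩, by omega, hd⟩, h3, h5⟩

/-- The point `(a z + b) / d` of the upper half plane, for `a, d > 0`. -/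
def affinePoint (z : ℍ) (a b d : ℤ) (ha : 0 < a) (hd : 0 < d) : ℍ :=
  ⟨((a : ℂ) * (z : ℂ) + (b : ℂ)) / (d : ℂ), by
    have ha' : (0 : ℝ) < a := by exact_mod_cast ha
    have hd' : (0 : ℝ) < d := by exact_mod_cast hd
    have h : (((a : ℂ) * (z : ℂ) + (b : ℂ)) / (d : ℂ)).im = a * z.im / d := by
      have h1 : ((d : ℤ) : ℂ) = ((d : ℝ) : ℂ) := by simp
      rw [h1, Complex.div_ofReal_im]
      simp
    rw [h]
    exact div_pos (mul_pos ha' z.im_pos) hd'⟩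

lemma affinePoint_im (z : ℍ) (a b d : ℤ) (ha : 0 < a) (hd : 0 < d) :
    (affinePoint z a b d ha hd).im = a * z.im / d := by
  have h1 : ((d : ℤ) : ℂ) = ((d : ℝ) : ℂ) := by simp
  change (((a : ℂ) * (z : ℂ) + (b : ℂ)) / (d : ℂ)).im = a * z.im / d
  rw [h1, Complex.div_ofReal_im]
  simp

/-- The vector `(√n / d) w` of `ℂ^m`. -/
def scaleVec (n : ℕ) (d : ℤ) (w : Fin m → ℂ) : Fin m → ℂ :=
  fun i => (((Real.sqrt (n : ℝ) / (d : ℝ) : ℝ)) : ℂ) * w i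

lemma sForm_scaleVec (n : ℕ) (a d : ℤ) (hd : 0 < d) (h : a * d = n) (w : Fin m → ℂ) :
    sForm S (fun i => (scaleVec n d w i).im) (fun i => (scaleVec n d w i).im)
      = (a / d : ℝ) * sForm S (fun i => (w i).im) (fun i => (w i).im) := by
  have hd' : (0 : ℝ) < d := by exact_mod_cast hd
  have hn : (a : ℝ) * d = n := by exact_mod_cast h
  have h1 : (fun i => (scaleVec n d w i).im)
      = (Real.sqrt (n : ℝ) / (d : ℝ)) • fun i => (w i).im := by
    funext i
    simp only [scaleVec, Complex.im_ofReal_mul, Pi.smul_apply, smul_eq_mul]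
  have h2 : (Real.sqrt (n : ℝ) / (d : ℝ)) * (Real.sqrt (n : ℝ) / (d : ℝ)) = (a / d : ℝ) := by
    rw [div_mul_div_comm, Real.mul_self_sqrt (Nat.cast_nonneg n), ← hn]
    field_simp
  rw [h1]
  simp only [map_smul, LinearMap.smul_apply, smul_eq_mul]
  rw [← mul_assoc, h2]

/-- The point `((a z + b) / d, (√n / d) w, z')` of the tube domain. -/
def TubeDomain.up (Z : TubeDomain S) (n : ℕ) (a b d : ℤ) (h : (a, b, d) ∈ heckeSet n) :
    TubeDomain S where
  z := affinePoint Z.z a b d (mem_heckeSet.1 h).1.1 (mem_heckeSet.1 h).1.2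
  w := scaleVec n d Z.w
  z' := Z.z'
  pos := by
    obtain ⟨⟨ha, hd⟩, hn, -⟩ := mem_heckeSet.1 h
    have had : (0 : ℝ) < (a / d : ℝ) :=
      div_pos (by exact_mod_cast ha) (by exact_mod_cast hd)
    rw [sForm_scaleVec n a d hd hn, affinePoint_im]
    refine lt_of_lt_of_eq (mul_pos had Z.pos) ?_
    ring

/-- The point `(z, (√n / d) w, (a z' + b) / d)` of the tube domain. -/
def TubeDomain.down (Z : TubeDomain S) (n : ℕ) (a b d : ℤ) (h : (a, b, d) ∈ heckeSet n) :
    TubeDomain S where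
  z := Z.z
  w := scaleVec n d Z.w
  z' := affinePoint Z.z' a b d (mem_heckeSet.1 h).1.1 (mem_heckeSet.1 h).1.2
  pos := by
    obtain ⟨⟨ha, hd⟩, hn, -⟩ := mem_heckeSet.1 h
    have had : (0 : ℝ) < (a / d : ℝ) :=
      div_pos (by exact_mod_cast ha) (by exact_mod_cast hd)
    rw [sForm_scaleVec n a d hd hn, affinePoint_im]
    refine lt_of_lt_of_eq (mul_pos had Z.pos) ?_
    ring

end SiegelTheta

end

open scoped UpperHalfPlane Matrix

noncomputable section

namespace SiegelTheta

/-! ### Integral matrices of degree two and their Hecke divisors -/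

/-! Both sides are sums of one and the same function over one coset, weighted by multiplicities that
count divisors of an integral matrix of degree two.

Write the hyperbolic coordinates of `l` as a matrix `X`, with signs such that `q(l) = det X -
S[x₀]/2`. A theta term depends on `l` and `Z` only through `q(l)` and `|Q(l, Z̃)|² / height`
(`thetaTerm_congr`). Hence a Hecke substitution in `z` can be moved to the vector, where it becomes
`X ↦ n^{-1/2} H X` with `H` of determinant `n`; in `z'` it becomes right multiplication by a lower
triangular matrix (`thetaTerm_up`, `thetaTerm_down`). The hyperbolic planes are unimodular, so in `α
+ L` the matrix `X` runs through all integral matrices independently of `x₀`. After rearrangement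
(`sum_tsum_comp_eq`) a vector with matrix `N` is weighted by the number of Hecke representatives
dividing `N` on the left, respectively on the right.

These numbers agree (`card_filter_heckeMatLower`). The left count depends only on the class of `N`
under unimodular matrices on both sides: on the right trivially, on the left because the
representatives stand for cosets that a unimodular factor permutes. Each class contains a diagonal
matrix, so transposition preserves the count and exchanges left with right.

The rearrangement needs absolute convergence. The norm of a term is a Gaussian in the majorant
`q(l_v) - q(l_{v^⊥})`, which is positive definite because `q` has no more than two positive
directions (`majorant_pos`). -/

/-- The upper triangular matrix with rows `(d, b)` and `(0, a)`, for `t = (a, b, d)`. -/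
def heckeMat (t : ℤ × ℤ × ℤ) : Matrix (Fin 2) (Fin 2) ℤ := !![t.2.2, t.2.1; 0, t.1]

/-- The lower triangular matrix with rows `(d, 0)` and `(-b, a)`, for `t = (a, b, d)`. -/
def heckeMatLower (t : ℤ × ℤ × ℤ) : Matrix (Fin 2) (Fin 2) ℤ := !![t.2.2, 0; -t.2.1, t.1]

lemma det_heckeMat (t : ℤ × ℤ × ℤ) : (heckeMat t).det = t.1 * t.2.2 := by
  simp [heckeMat, Matrix.det_fin_two_of, mul_comm]

lemma det_heckeMatLower (t : ℤ × ℤ × ℤ) : (heckeMatLower t).det = t.1 * t.2.2 := by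
  simp [heckeMatLower, Matrix.det_fin_two_of, mul_comm]

lemma of_fin_two_congr {R : Type*} {a b c d a' b' c' d' : R} (h₁ : a = a') (h₂ : b = b')
    (h₃ : c = c') (h₄ : d = d') : !![a, b; c, d] = !![a', b'; c', d'] := by
  rw [h₁, h₂, h₃, h₄]

/-- Hermite normal form: an integral matrix of determinant `± n` is, up to multiplication by a
unimodular matrix on the right, one of the matrices `heckeMat t`. -/
lemma exists_mul_eq_heckeMat {n : ℕ} (hn : 1 ≤ n) (A : Matrix (Fin 2) (Fin 2) ℤ)
    (hA : A.det.natAbs = n) :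
    ∃ W : Matrix (Fin 2) (Fin 2) ℤ, IsUnit W.det ∧ ∃ t ∈ heckeSet n, A * W = heckeMat t := by
  obtain ⟨r', hr⟩ : (Int.gcd (A 1 0) (A 1 1) : ℤ) ∣ A 1 0 := Int.gcd_dvd_left ..
  obtain ⟨s', hs⟩ : (Int.gcd (A 1 0) (A 1 1) : ℤ) ∣ A 1 1 := Int.gcd_dvd_right ..
  have hb := Int.gcd_eq_gcd_ab (A 1 0) (A 1 1)
  generalize Int.gcdA (A 1 0) (A 1 1) = x at hb
  generalize Int.gcdB (A 1 0) (A 1 1) = y at hb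
  have hg0 : (0 : ℤ) ≤ (Int.gcd (A 1 0) (A 1 1) : ℤ) := by positivity
  generalize (Int.gcd (A 1 0) (A 1 1) : ℤ) = g at *
  -- `(p, k)` is the top row after the unimodular column operation that turns the bottom row into
  -- `(0, g)`, with `g` its gcd.
  set p := A 0 0 * s' - A 0 1 * r' with hp
  set k := A 0 0 * x + A 0 1 * y with hk
  have hdet : A.det = p * g := by
    rw [Matrix.det_fin_two, hr, hs, hp]; ring
  have hpg : p * g ≠ 0 := by
    rw [← hdet]; intro h; rw [h] at hA; simp at hA; omega
  have hp0 : p ≠ 0 := left_ne_zero_of_mul hpg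
  have hgpos : 0 < g := lt_of_le_of_ne hg0 (right_ne_zero_of_mul hpg).symm
  have hbez : r' * x + s' * y = 1 := by
    have : g * (r' * x + s' * y) = g * 1 := by
      rw [hr, hs] at hb; linear_combination -hb
    exact mul_left_cancel₀ hgpos.ne' this
  have hsign : p * p.sign = |p| := by rw [mul_comm, Int.sign_mul_self_eq_abs]
  have habs : 0 < |p| := abs_pos.2 hp0
  have hunit : IsUnit p.sign := by
    rcases lt_or_gt_of_ne hp0 with h | h
    · rw [Int.sign_eq_neg_one_of_neg h]; decide
    · rw [Int.sign_eq_one_of_pos h]; exact isUnit_one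
  -- The second factor makes the corner `|p|` and reduces `k` modulo `|p|`.
  refine ⟨!![s', x; -r', y] * !![p.sign, -(p.sign * (k / |p|)); 0, 1], ?_,
    (g, k % |p|, |p|), ?_, ?_⟩
  · rw [Matrix.det_mul, Matrix.det_fin_two_of, Matrix.det_fin_two_of]
    have : (s' * y - x * -r') = 1 := by linear_combination hbez
    rw [this]
    simpa using hunit
  · rw [mem_heckeSet]
    refine ⟨⟨hgpos, habs⟩, ?_, Int.emod_nonneg _ habs.ne', Int.emod_lt_of_pos _ habs⟩
    rw [← hA, hdet, Int.natCast_natAbs, abs_mul, abs_of_pos hgpos, mul_comm]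
  · have h1 : A * !![s', x; -r', y] = !![p, k; 0, g] := by
      rw [Matrix.eta_fin_two A, Matrix.mul_fin_two, hp, hk]
      refine of_fin_two_congr (by ring) rfl ?_ ?_
      · rw [hr, hs]; ring
      · rw [hr, hs]; linear_combination g * hbez
    rw [← Matrix.mul_assoc, h1, heckeMat, Matrix.mul_fin_two]
    have h2 := Int.emod_add_mul_ediv k |p|
    refine of_fin_two_congr (by simp [hsign]) ?_ (by simp) (by simp)
    linear_combination -h2 - (k / |p|) * hsign

/-- Uniqueness of the Hermite normal form. -/
lemma eq_of_heckeMat_eq_mul {n : ℕ} {t t' : ℤ × ℤ × ℤ} (ht : t ∈ heckeSet n)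
    (ht' : t' ∈ heckeSet n) {W : Matrix (Fin 2) (Fin 2) ℤ} (h : heckeMat t = heckeMat t' * W) :
    t = t' := by
  obtain ⟨a, b, d⟩ := t
  obtain ⟨a', b', d'⟩ := t'
  obtain ⟨⟨ha, hd⟩, hn, hb0, hbd⟩ := mem_heckeSet.1 ht
  obtain ⟨⟨ha', hd'⟩, hn', hb0', hbd'⟩ := mem_heckeSet.1 ht'
  rw [Matrix.eta_fin_two W] at h
  simp only [heckeMat, Matrix.mul_fin_two] at h
  have h00 := congrFun₂ h 0 0
  have h01 := congrFun₂ h 0 1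
  have h10 := congrFun₂ h 1 0
  have h11 := congrFun₂ h 1 1
  simp at h00 h01 h10 h11
  have hw : W 1 0 = 0 := h10.resolve_left ha'.ne'
  rw [hw] at h00
  have hw0 : 0 < W 0 0 := by
    by_contra hc
    nlinarith
  have hw1 : 0 < W 1 1 := by
    by_contra hc
    nlinarith
  have hprod : W 0 0 * W 1 1 = 1 := by
    have : (a' * d') * (W 0 0 * W 1 1) = (a' * d') * 1 := by
      rw [h11, h00] at hn
      linear_combination hn - hn'
    exact mul_left_cancel₀ (mul_pos ha' hd').ne' this
  have e0 : W 0 0 = 1 := Int.eq_one_of_mul_eq_one_right hw0.le hprod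
  have e1 : W 1 1 = 1 := by rw [e0] at hprod; linarith
  rw [e0] at h00
  rw [e1] at h11 h01
  -- Here `b = d' * W 0 1 + b'` with `b` and `b'` both in `[0, d')`.
  have hv : W 0 1 = 0 := by
    have l1 : W 0 1 < 1 := by
      by_contra hc
      nlinarith
    have l2 : -1 < W 0 1 := by
      by_contra hc
      nlinarith
    omega
  rw [hv] at h01
  simp at h00 h01 h11
  simp [h00, h01, h11]

/-! ### Counting left divisors under unimodular multiplication -/

open Classical in
/-- The Hecke representatives which divide a matrix on the left. -/
def leftDivisors (n : ℕ) (N : Matrix (Fin 2) (Fin 2) ℤ) : Finset (ℤ × ℤ × ℤ) :=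
  (heckeSet n).filter fun t => ∃ M, heckeMat t * M = N

lemma mem_leftDivisors {n : ℕ} {N : Matrix (Fin 2) (Fin 2) ℤ} {t : ℤ × ℤ × ℤ} :
    t ∈ leftDivisors n N ↔ t ∈ heckeSet n ∧ ∃ M, heckeMat t * M = N := by
  simp [leftDivisors]

lemma leftDivisors_mul_right (n : ℕ) (N : Matrix (Fin 2) (Fin 2) ℤ)
    {W : Matrix (Fin 2) (Fin 2) ℤ} (hW : IsUnit W.det) :
    leftDivisors n (N * W) = leftDivisors n N := by
  ext t
  simp only [mem_leftDivisors, and_congr_right_iff]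
  refine fun _ => ⟨fun ⟨M, hM⟩ => ⟨M * W⁻¹, ?_⟩, fun ⟨M, hM⟩ => ⟨M * W, ?_⟩⟩
  · rw [← Matrix.mul_assoc, hM, Matrix.mul_assoc, Matrix.mul_nonsing_inv _ hW, Matrix.mul_one]
  · rw [← Matrix.mul_assoc, hM]

/-- Left multiplication by `U` carries the coset of `heckeMat t` modulo right unimodular factors to
another such coset. Existence of the normal form names its representative, and uniqueness makes the
resulting map on divisors injective. -/
lemma card_leftDivisors_le_mul_left {n : ℕ} (hn : 1 ≤ n) (N : Matrix (Fin 2) (Fin 2) ℤ)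
    {U : Matrix (Fin 2) (Fin 2) ℤ} (hU : IsUnit U.det) :
    (leftDivisors n N).card ≤ (leftDivisors n (U * N)).card := by
  have key : ∀ t ∈ heckeSet n, ∃ W : Matrix (Fin 2) (Fin 2) ℤ, IsUnit W.det ∧
      ∃ t' ∈ heckeSet n, U * heckeMat t * W = heckeMat t' := by
    rintro ⟨a, b, d⟩ ht
    refine exists_mul_eq_heckeMat hn _ ?_
    rw [Matrix.det_mul, det_heckeMat, Int.natAbs_mul, Int.isUnit_iff_natAbs_eq.1 hU, one_mul,
      (mem_heckeSet.1 ht).2.1, Int.natAbs_natCast]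
  choose! W hW f hf hWf using key
  refine Finset.card_le_card_of_injOn f (fun t ht => ?_) fun t ht t' ht' h => ?_
  · obtain ⟨ht, M, hM⟩ := mem_leftDivisors.1 ht
    refine mem_leftDivisors.2 ⟨hf t ht, (W t)⁻¹ * M, ?_⟩
    rw [← hWf t ht, ← hM, Matrix.mul_assoc (U * heckeMat t), ← Matrix.mul_assoc (W t),
      Matrix.mul_nonsing_inv _ (hW t ht), Matrix.one_mul, Matrix.mul_assoc]
  · have ht := (mem_leftDivisors.1 ht).1
    have ht' := (mem_leftDivisors.1 ht').1
    refine eq_of_heckeMat_eq_mul ht ht' (W := W t' * (W t)⁻¹) ?_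
    have h1 : U * heckeMat t * W t = U * heckeMat t' * W t' := by
      rw [hWf t ht, hWf t' ht', h]
    have h2 : heckeMat t * W t = heckeMat t' * W t' := by
      have := congrArg (U⁻¹ * ·) h1
      simpa only [← Matrix.mul_assoc, Matrix.nonsing_inv_mul _ hU, Matrix.one_mul] using this
    rw [← Matrix.mul_assoc, ← h2, Matrix.mul_assoc, Matrix.mul_nonsing_inv _ (hW t ht),
      Matrix.mul_one]

lemma card_leftDivisors_mul_left {n : ℕ} (hn : 1 ≤ n) (N : Matrix (Fin 2) (Fin 2) ℤ)
    {U : Matrix (Fin 2) (Fin 2) ℤ} (hU : IsUnit U.det) :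
    (leftDivisors n (U * N)).card = (leftDivisors n N).card := by
  refine le_antisymm ?_ (card_leftDivisors_le_mul_left hn N hU)
  have := card_leftDivisors_le_mul_left hn (U * N) (U := U⁻¹) (by simpa using hU)
  rwa [← Matrix.mul_assoc, Matrix.nonsing_inv_mul _ hU, Matrix.one_mul] at this

/-! ### Elementary divisors and transposition -/

lemma exists_minimal_nat {p : ℕ → Prop} (h : ∃ k, p k) : ∃ k, p k ∧ ∀ j < k, ¬ p j := by
  classical
  exact ⟨Nat.find h, Nat.find_spec h, fun _ => Nat.find_min h⟩

/-- Elementary divisors: an integral matrix of degree two can be diagonalized by unimodular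
matrices. -/
lemma exists_unimodular_diagonal (N : Matrix (Fin 2) (Fin 2) ℤ) :
    ∃ U W : Matrix (Fin 2) (Fin 2) ℤ, IsUnit U.det ∧ IsUnit W.det ∧
      ∃ x y : ℤ, U * N * W = !![x, 0; 0, y] := by
  -- Among all equivalent matrices with nonzero corner, take one whose corner is smallest in
  -- absolute value; it must divide its row and its column.
  by_cases hN : ∃ k : ℕ, ∃ U W : Matrix (Fin 2) (Fin 2) ℤ, IsUnit U.det ∧ IsUnit W.det ∧
      k ≠ 0 ∧ ((U * N * W) 0 0).natAbs = k
  · obtain ⟨k, ⟨U, W, hU, hW, hk, hUW⟩, hmin⟩ := exists_minimal_nat hN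
    set M := U * N * W with hM
    have hp : M 0 0 ≠ 0 := by intro h; apply hk; rw [← hUW, h]; rfl
    have hlt (z : ℤ) : (z % M 0 0).natAbs < k := by
      have h1 := Int.emod_nonneg z hp
      have h2 := Int.emod_lt_abs z hp
      have h3 := Int.natCast_natAbs (M 0 0)
      omega
    have hcol : M 1 0 % M 0 0 = 0 := by
      by_contra hc
      -- This row operation brings the remainder of `M 1 0` into the corner, against minimality.
      refine hmin _ (hlt (M 1 0)) ⟨!![-(M 1 0 / M 0 0), 1; 1, 0] * U, W, ?_, hW, ?_, ?_⟩
      · rw [Matrix.det_mul, Matrix.det_fin_two_of]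
        simpa using hU
      · simpa using hc
      · rw [Matrix.mul_assoc _ U, Matrix.mul_assoc _ (U * N), ← hM, Matrix.eta_fin_two M,
          Matrix.mul_fin_two]
        have := Int.emod_add_mul_ediv (M 1 0) (M 0 0)
        simp
        congr 1
        linear_combination -this
    have hrow : M 0 1 % M 0 0 = 0 := by
      by_contra hc
      refine hmin _ (hlt (M 0 1)) ⟨U, W * !![-(M 0 1 / M 0 0), 1; 1, 0], hU, ?_, ?_, ?_⟩
      · rw [Matrix.det_mul, Matrix.det_fin_two_of]
        simpa using hW
      · simpa using hc
      · rw [← Matrix.mul_assoc, ← hM, Matrix.eta_fin_two M, Matrix.mul_fin_two]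
        have := Int.emod_add_mul_ediv (M 0 1) (M 0 0)
        simp
        congr 1
        linear_combination -this
    obtain ⟨u, hu⟩ := Int.dvd_of_emod_eq_zero hcol
    obtain ⟨w, hw⟩ := Int.dvd_of_emod_eq_zero hrow
    refine ⟨!![1, 0; -u, 1] * U, W * !![1, -w; 0, 1], ?_, ?_, M 0 0, M 1 1 - u * (M 0 0 * w), ?_⟩
    · rw [Matrix.det_mul, Matrix.det_fin_two_of]
      simpa using hU
    · rw [Matrix.det_mul, Matrix.det_fin_two_of]
      simpa using hW
    · rw [← Matrix.mul_assoc, Matrix.mul_assoc _ U, Matrix.mul_assoc _ (U * N), ← hM]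
      conv_lhs => rw [Matrix.eta_fin_two M, Matrix.mul_fin_two, Matrix.mul_fin_two, hu, hw]
      refine of_fin_two_congr ?_ ?_ ?_ ?_ <;> ring
  -- If the corner vanishes for every equivalent matrix, swapping rows or columns shows that the
  -- off-diagonal entries of `N` vanish too.
  · push Not at hN
    have h (U W : Matrix (Fin 2) (Fin 2) ℤ) (hU : IsUnit U.det) (hW : IsUnit W.det) :
        (U * N * W) 0 0 = 0 := by
      by_contra hc
      exact hN _ U W hU hW (Int.natAbs_ne_zero.2 hc) rfl
    have hs : IsUnit (!![0, 1; 1, 0] : Matrix (Fin 2) (Fin 2) ℤ).det := by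
      simp [Matrix.det_fin_two_of]
    have h1 : IsUnit (1 : Matrix (Fin 2) (Fin 2) ℤ).det := by simp
    have e01 := h 1 _ h1 hs
    have e10 := h _ 1 hs h1
    have e00 := h 1 1 h1 h1
    refine ⟨1, 1, h1, h1, N 0 0, N 1 1, ?_⟩
    rw [Matrix.eta_fin_two N] at e01 e10 e00
    simp [Matrix.mul_apply, Fin.sum_univ_two] at e01 e10 e00
    rw [Matrix.one_mul, Matrix.mul_one]
    conv_lhs => rw [Matrix.eta_fin_two N]
    rw [e01, e10]

/-- `N` and its transpose are equivalent to the same diagonal matrix. -/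
lemma card_leftDivisors_transpose {n : ℕ} (hn : 1 ≤ n) (N : Matrix (Fin 2) (Fin 2) ℤ) :
    (leftDivisors n Nᵀ).card = (leftDivisors n N).card := by
  obtain ⟨U, W, hU, hW, x, y, h⟩ := exists_unimodular_diagonal N
  have h' : Wᵀ * Nᵀ * Uᵀ = !![x, 0; 0, y] := by
    have := congrArg Matrix.transpose h
    rw [Matrix.transpose_mul, Matrix.transpose_mul, ← Matrix.mul_assoc] at this
    rw [this]
    ext i j; fin_cases i <;> fin_cases j <;> rfl
  rw [← card_leftDivisors_mul_left hn N hU, ← leftDivisors_mul_right n (U * N) hW, h, ← h',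
    leftDivisors_mul_right n _ (by rwa [Matrix.det_transpose]),
    card_leftDivisors_mul_left hn _ (by rwa [Matrix.det_transpose])]

/-- Transposition exchanges the two sides, and conjugation by `diag(1, -1)` corrects the sign of
`b`. -/
lemma exists_mul_heckeMatLower_iff (t : ℤ × ℤ × ℤ) (N : Matrix (Fin 2) (Fin 2) ℤ) :
    (∃ M, M * heckeMatLower t = N) ↔ ∃ M, heckeMat t * M = !![1, 0; 0, -1] * Nᵀ := by
  have hE : (!![1, 0; 0, -1] : Matrix (Fin 2) (Fin 2) ℤ) * !![1, 0; 0, -1] = 1 := by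
    ext i j; fin_cases i <;> fin_cases j <;> simp
  have hH : heckeMat t * !![1, 0; 0, -1] = !![1, 0; 0, -1] * (heckeMatLower t)ᵀ := by
    ext i j
    fin_cases i <;> fin_cases j <;>
      simp [heckeMat, heckeMatLower, Matrix.mul_apply, Fin.sum_univ_two]
  constructor
  · rintro ⟨M, rfl⟩
    refine ⟨!![1, 0; 0, -1] * Mᵀ, ?_⟩
    rw [← Matrix.mul_assoc, hH, Matrix.transpose_mul, Matrix.mul_assoc]
  · rintro ⟨M, hM⟩
    refine ⟨(!![1, 0; 0, -1] * M)ᵀ, Matrix.transpose_injective ?_⟩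
    have hN : Nᵀ = !![1, 0; 0, -1] * (heckeMat t * M) := by
      rw [hM, ← Matrix.mul_assoc, hE, Matrix.one_mul]
    have hH' : !![1, 0; 0, -1] * heckeMat t = (heckeMatLower t)ᵀ * !![1, 0; 0, -1] := by
      ext i j
      fin_cases i <;> fin_cases j <;>
        simp [heckeMat, heckeMatLower, Matrix.mul_apply, Fin.sum_univ_two]
    rw [hN, Matrix.transpose_mul, Matrix.transpose_transpose, ← Matrix.mul_assoc,
      ← Matrix.mul_assoc, hH']

open Classical in
/-- A matrix has as many Hecke divisors on the left as on the right. -/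
lemma card_filter_heckeMatLower {n : ℕ} (hn : 1 ≤ n) (N : Matrix (Fin 2) (Fin 2) ℤ) :
    ((heckeSet n).filter fun t => ∃ M, heckeMat t * M = N).card =
      ((heckeSet n).filter fun t => ∃ M, M * heckeMatLower t = N).card := by
  have h := card_leftDivisors_mul_left hn Nᵀ (U := !![1, 0; 0, -1])
    (by simp [Matrix.det_fin_two_of])
  rw [card_leftDivisors_transpose hn] at h
  simp only [leftDivisors, ← exists_mul_heckeMatLower_iff] at h
  exact h.symm

variable {m : ℕ} {S : EvenPosDefMatrix m}

/-! ### The terms of the theta series in coordinates -/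

/-- The quantity `2 Im(z) Im(z') - S[Im(w)]`. -/
def TubeDomain.height (Z : TubeDomain S) : ℝ :=
  2 * Z.z.im * Z.z'.im - sForm S (fun i => (Z.w i).im) (fun i => (Z.w i).im)

lemma TubeDomain.height_pos (Z : TubeDomain S) : 0 < Z.height := Z.pos

/-- The pairing `Q(l, Z̃)`, for the complex bilinear extension of `Q`. -/
def TubeDomain.pairing (Z : TubeDomain S) (l : V m) : ℂ := ⟨Q S l Z.reTilde, Q S l Z.imTilde⟩

lemma Q_symm (x y : V m) : Q S x y = Q S y x := by
  rw [Q_apply, Q_apply, sForm_symm]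
  ring

lemma sFormC_ofReal (x : Fin m → ℝ) (w : Fin m → ℂ) :
    sFormC S (fun i => (x i : ℂ)) w =
      ⟨sForm S x (fun i => (w i).re), sForm S x (fun i => (w i).im)⟩ := by
  apply Complex.ext
  · simp only [sFormC, sForm, Matrix.toBilin'_apply, Complex.re_sum]
    refine Finset.sum_congr rfl fun i _ => Finset.sum_congr rfl fun j _ => ?_
    simp
  · simp only [sFormC, sForm, Matrix.toBilin'_apply, Complex.im_sum]
    refine Finset.sum_congr rfl fun i _ => Finset.sum_congr rfl fun j _ => ?_
    simp

lemma pairing_eq (Z : TubeDomain S) (l : V m) :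
    Z.pairing l = l (.inl 0) + l (.inl 1) * (Z.z' : ℂ)
      - sFormC S (fun i => (l (.inr (.inl i)) : ℂ)) Z.w + l (.inr (.inr 0)) * (Z.z : ℂ)
      - l (.inr (.inr 1)) * ((Z.z : ℂ) * (Z.z' : ℂ) - sFormC S Z.w Z.w / 2) := by
  rw [TubeDomain.pairing, Q_apply, Q_apply, sFormC_ofReal]
  apply Complex.ext
  · simp [TubeDomain.reTilde, TubeDomain.tilde]
    ring
  · simp [TubeDomain.imTilde, TubeDomain.tilde]
    ring

/-- The real and imaginary parts of `Z̃` are orthogonal and both have `Q`-norm `height`, so the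
usual formula for an orthogonal basis applies. -/
lemma proj_toGr (Z : TubeDomain S) (l : V m) :
    Z.toGr.proj l =
      (Q S l Z.reTilde / Z.height) • Z.reTilde + (Q S l Z.imTilde / Z.height) • Z.imTilde := by
  set p := (Q S l Z.reTilde / Z.height) • Z.reTilde + (Q S l Z.imTilde / Z.height) • Z.imTilde
    with hp
  have hmem : p ∈ Z.toGr.space := Submodule.mem_span_pair.2 ⟨_, _, rfl⟩
  have hh := Z.height_pos.ne'
  have horth : l - p ∈ (Q S).orthogonal Z.toGr.space := by
    rw [LinearMap.BilinForm.mem_orthogonal_iff]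
    intro x hx
    obtain ⟨a, b, rfl⟩ := Submodule.mem_span_pair.1 hx
    have h1 : Q S Z.reTilde Z.reTilde = Z.height := Q_re_re Z
    have h2 : Q S Z.imTilde Z.imTilde = Z.height := Q_im_im Z
    have h3 := Q_re_im Z
    have h4 := (Q_symm Z.imTilde Z.reTilde).trans h3
    change Q S _ _ = 0
    simp only [hp, map_add, map_sub, map_smul, LinearMap.add_apply, LinearMap.smul_apply,
      smul_eq_mul, h1, h2, h3, h4, Q_symm Z.reTilde l, Q_symm Z.imTilde l]
    field_simp
    ring
  have h : l = p + (l - p) := by abel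
  conv_lhs => rw [h]
  rw [Gr.proj, map_add, Submodule.projection_apply_of_mem_left _ hmem,
    (Submodule.projection_apply_eq_zero_iff _).2 horth, add_zero]

lemma projPerp_eq (v : Gr S) (l : V m) : v.projPerp l = l - v.proj l :=
  Submodule.projection_eq_self_sub_projection _ _

lemma q_proj_toGr (Z : TubeDomain S) (l : V m) :
    q S (Z.toGr.proj l) = Complex.normSq (Z.pairing l) / (2 * Z.height) := by
  have hh := Z.height_pos.ne'
  rw [proj_toGr, q_comb, ← TubeDomain.height, Complex.normSq_apply, TubeDomain.pairing]
  field_simp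

lemma q_projPerp (v : Gr S) (l : V m) :
    q S (v.projPerp l) = q S l - q S (v.proj l) := by
  have hmem : v.proj l ∈ v.space := Submodule.projection_apply_mem _ _
  have horth : l - v.proj l ∈ (Q S).orthogonal v.space := by
    rw [← projPerp_eq]
    exact Submodule.projection_apply_mem _ _
  have h : Q S (v.proj l) (l - v.proj l) = 0 := horth _ hmem
  have hs := Q_symm (S := S) (v.proj l) l
  rw [map_sub] at h
  simp only [projPerp_eq, q, map_sub, LinearMap.sub_apply]
  linarith

/-- The positive definite majorant `q(l_v) - q(l_{v^⊥})` of `q` at `v = v_Z`. -/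
def TubeDomain.majorant (Z : TubeDomain S) (l : V m) : ℝ :=
  Complex.normSq (Z.pairing l) / Z.height - q S l

/-- The real part of `τ` meets the sum of `q(l_v)` and `q(l_{v^⊥})`, which is `q(l)`; the imaginary
part meets their difference, the majorant. -/
lemma thetaTerm_toGr (τ : ℍ) (Z : TubeDomain S) (l : V m) :
    thetaTerm τ Z.toGr l = Complex.exp (2 * Real.pi * Complex.I *
      ((τ : ℂ).re * (q S l : ℂ) + Complex.I * (τ : ℂ).im * (Z.majorant l : ℂ))) := by
  rw [thetaTerm, q_projPerp, q_proj_toGr, TubeDomain.majorant]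
  have h1 : (τ : ℂ) = (τ : ℂ).re + (τ : ℂ).im * Complex.I := (Complex.re_add_im _).symm
  have h2 : (starRingEnd ℂ) (τ : ℂ) = (τ : ℂ).re - (τ : ℂ).im * Complex.I := by
    apply Complex.ext <;> simp
  have hh : (Z.height : ℂ) ≠ 0 := by exact_mod_cast Z.height_pos.ne'
  rw [h2]
  generalize (τ : ℂ).re = x at *
  generalize (τ : ℂ).im = y at *
  rw [h1]
  congr 2
  push_cast
  field_simp
  ring

lemma norm_thetaTerm (τ : ℍ) (Z : TubeDomain S) (l : V m) :
    ‖thetaTerm τ Z.toGr l‖ = Real.exp (-(2 * Real.pi * τ.im * Z.majorant l)) := by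
  rw [thetaTerm_toGr, Complex.norm_exp]
  congr 1
  simp
  ring

lemma thetaTerm_congr (τ : ℍ) {Z Z' : TubeDomain S} {l l' : V m} (hq : q S l = q S l')
    (hp : Complex.normSq (Z.pairing l) / Z.height = Complex.normSq (Z'.pairing l') / Z'.height) :
    thetaTerm τ Z.toGr l = thetaTerm τ Z'.toGr l' := by
  rw [thetaTerm_toGr, thetaTerm_toGr, TubeDomain.majorant, TubeDomain.majorant, hp, hq]

/-! ### Absolute convergence -/

lemma sForm_self_pos {x : Fin m → ℝ} (hx : x ≠ 0) : 0 < sForm S x x := by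
  have h := S.posDef.dotProduct_mulVec_pos hx
  rw [sForm, Matrix.toBilin'_apply']
  simpa using h

lemma sForm_self_nonneg (x : Fin m → ℝ) : 0 ≤ sForm S x x := by
  rcases eq_or_ne x 0 with rfl | hx
  · simp
  · exact (sForm_self_pos hx).le

/-- The form `q` is negative definite on a subspace of codimension two. -/
lemma eq_zero_of_q_nonneg {u : V m} (h1 : u (.inl 0) + u (.inr (.inr 1)) = 0)
    (h2 : u (.inl 1) + u (.inr (.inr 0)) = 0) (hq : 0 ≤ q S u) : u = 0 := by
  have e1 : u (.inl 0) = -u (.inr (.inr 1)) := by linarith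
  have e2 : u (.inl 1) = -u (.inr (.inr 0)) := by linarith
  have hS := sForm_self_nonneg (S := S) fun i => u (.inr (.inl i))
  -- On this subspace `q(u) = -u₃² - u₄² - S[u₀]/2`.
  rw [q, Q_apply, e1, e2] at hq
  have f1 : u (.inr (.inr 1)) = 0 := by
    nlinarith [sq_nonneg (u (.inr (.inr 1))), sq_nonneg (u (.inr (.inr 0)))]
  have f2 : u (.inr (.inr 0)) = 0 := by
    nlinarith [sq_nonneg (u (.inr (.inr 1))), sq_nonneg (u (.inr (.inr 0)))]
  have f3 : (fun i => u (.inr (.inl i))) = 0 := by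
    by_contra hne
    have := sForm_self_pos (S := S) hne
    rw [f1, f2] at hq
    linarith
  rw [f1, neg_zero] at e1
  rw [f2, neg_zero] at e2
  funext i
  rcases i with i | i | i
  · fin_cases i
    exacts [e1, e2]
  · exact congrFun f3 i
  · fin_cases i
    exacts [f2, f1]

/-- The form `q` is negative definite on the orthogonal complement of `v_Z`. -/
lemma q_neg_of_orthogonal (Z : TubeDomain S) {r : V m} (hr : r ≠ 0)
    (hre : Q S r Z.reTilde = 0) (him : Q S r Z.imTilde = 0) : q S r < 0 := by
  by_contra! hq
  -- If `q(r) ≥ 0`, then `q` is nonnegative on all combinations of `Z̃`'s two parts and `r`. Three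
  -- parameters against the two conditions `f` leave a nontrivial combination in the space where `q`
  -- is negative definite.
  let g : (Fin 3 → ℝ) →ₗ[ℝ] V m := Fintype.linearCombination ℝ ![Z.reTilde, Z.imTilde, r]
  let f : V m →ₗ[ℝ] Fin 2 → ℝ := LinearMap.pi
    ![LinearMap.proj (.inl 0) + LinearMap.proj (.inr (.inr 1)),
      LinearMap.proj (.inl 1) + LinearMap.proj (.inr (.inr 0))]
  have hker : LinearMap.ker (f ∘ₗ g) ≠ ⊥ := LinearMap.ker_ne_bot_of_finrank_lt (by simp)
  obtain ⟨c, hc, hc0⟩ := (Submodule.ne_bot_iff _).1 hker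
  have hg : g c = (c 0 • Z.reTilde + c 1 • Z.imTilde) + c 2 • r := by
    simp [g, Fintype.linearCombination_apply, Fin.sum_univ_three]
  have hf : f (g c) = 0 := hc
  have h1 : g c (.inl 0) + g c (.inr (.inr 1)) = 0 := congrFun hf 0
  have h2 : g c (.inl 1) + g c (.inr (.inr 0)) = 0 := congrFun hf 1
  have hqg : q S (g c) = (c 0 ^ 2 + c 1 ^ 2) * Z.height / 2 + c 2 ^ 2 * q S r := by
    rw [TubeDomain.height, ← q_comb, hg]
    have hre' := (Q_symm Z.reTilde r).trans hre
    have him' := (Q_symm Z.imTilde r).trans him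
    simp only [q, map_add, map_smul, LinearMap.add_apply, LinearMap.smul_apply, smul_eq_mul,
      hre, him, hre', him']
    ring
  have hh := Z.height_pos
  have hz : g c = 0 := eq_zero_of_q_nonneg (S := S) h1 h2 (by rw [hqg]; positivity)
  have hq0 : q S (g c) = 0 := by simp [hz, q]
  rw [hqg] at hq0
  have hsum : c 0 ^ 2 + c 1 ^ 2 = 0 := by
    have a1 : 0 ≤ (c 0 ^ 2 + c 1 ^ 2) * Z.height / 2 := by positivity
    have a2 : 0 ≤ c 2 ^ 2 * q S r := by positivity
    have a3 : (c 0 ^ 2 + c 1 ^ 2) * Z.height = 0 := by linarith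
    exact (mul_eq_zero.1 a3).resolve_right hh.ne'
  have c0 : c 0 = 0 := by nlinarith [sq_nonneg (c 0), sq_nonneg (c 1)]
  have c1 : c 1 = 0 := by nlinarith [sq_nonneg (c 0), sq_nonneg (c 1)]
  rw [hz, c0, c1] at hg
  have c2 : c 2 = 0 := by
    have : c 2 • r = 0 := by simpa using hg.symm
    exact (smul_eq_zero.1 this).resolve_right hr
  apply hc0
  funext i
  fin_cases i
  exacts [c0, c1, c2]

lemma majorant_pos (Z : TubeDomain S) {l : V m} (hl : l ≠ 0) : 0 < Z.majorant l := by
  have hmaj : Z.majorant l = q S (Z.toGr.proj l) - q S (Z.toGr.projPerp l) := by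
    have hh := Z.height_pos.ne'
    rw [q_projPerp, q_proj_toGr, TubeDomain.majorant]
    field_simp
    ring
  rw [hmaj]
  have hneg (hr : Z.toGr.projPerp l ≠ 0) : q S (Z.toGr.projPerp l) < 0 := by
    have horth : Z.toGr.projPerp l ∈ (Q S).orthogonal Z.toGr.space :=
      Submodule.projection_apply_mem _ _
    refine q_neg_of_orthogonal Z hr ?_ ?_ <;> rw [Q_symm]
    · exact horth _ (Submodule.subset_span (by simp))
    · exact horth _ (Submodule.subset_span (by simp))
  by_cases hp : Z.toGr.proj l = 0
  · have : Z.toGr.projPerp l = l := by rw [projPerp_eq, hp, sub_zero]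
    have h2 := hneg (by rwa [this])
    rw [hp]
    simpa [q] using h2
  · have h1 : 0 < q S (Z.toGr.proj l) :=
      Z.toGr.pos _ (Submodule.projection_apply_mem _ _) hp
    by_cases hr : Z.toGr.projPerp l = 0
    · rw [hr]
      simpa [q] using h1
    · have := hneg hr
      linarith

lemma majorant_smul (Z : TubeDomain S) (c : ℝ) (l : V m) :
    Z.majorant (c • l) = c ^ 2 * Z.majorant l := by
  simp only [TubeDomain.majorant, TubeDomain.pairing, q, Complex.normSq_apply, map_smul,
    LinearMap.smul_apply, smul_eq_mul]
  ring

lemma continuous_majorant (Z : TubeDomain S) : Continuous Z.majorant := by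
  unfold TubeDomain.majorant TubeDomain.pairing q Q
  simp only [Complex.normSq_apply, Matrix.toBilin'_apply]
  fun_prop

/-- The majorant attains a positive minimum on the compact unit sphere, and it is homogeneous of
degree two. -/
lemma exists_le_majorant (Z : TubeDomain S) :
    ∃ c > 0, ∀ l : V m, c * ‖l‖ ^ 2 ≤ Z.majorant l := by
  obtain ⟨x, hx, hmin⟩ := (isCompact_sphere (0 : V m) 1).exists_isMinOn
    (NormedSpace.sphere_nonempty.2 zero_le_one) (continuous_majorant Z).continuousOn
  have hx0 : x ≠ 0 := by
    rintro rfl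
    simp at hx
  refine ⟨Z.majorant x, majorant_pos Z hx0, fun l => ?_⟩
  rcases eq_or_ne l 0 with rfl | hl
  · simp [TubeDomain.majorant, TubeDomain.pairing, q, Complex.normSq_apply]
  · have hl' : ‖l‖ ≠ 0 := norm_ne_zero_iff.2 hl
    have h1 : Z.majorant x ≤ Z.majorant (‖l‖⁻¹ • l) := hmin (by simp [norm_smul, hl'])
    rw [majorant_smul] at h1
    calc Z.majorant x * ‖l‖ ^ 2 ≤ (‖l‖⁻¹ ^ 2 * Z.majorant l) * ‖l‖ ^ 2 := by gcongr
      _ = Z.majorant l := by field_simp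

/-- A Gaussian is summable over a translate of a lattice. -/
lemma summable_exp_neg_mul_norm_sub_sq {E : Type*} [NormedAddCommGroup E] [NormedSpace ℝ E]
    [FiniteDimensional ℝ E] (L : Submodule ℤ E) [DiscreteTopology L] {c : ℝ} (hc : 0 < c)
    (x : E) : Summable fun z : L => Real.exp (-(c * ‖(z : E) - x‖ ^ 2)) := by
  -- With this choice `2 * N` exceeds the rank, so the comparison series of inverse powers
  -- converges.
  set N := Module.finrank ℤ L + 1
  have hs := (ZLattice.summable_norm_sub_inv_pow L (2 * N) (by omega) x).mul_left
    (N.factorial / c ^ N : ℝ)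
  refine Summable.of_norm_bounded_eventually hs ?_
  -- The bound `exp(-u) ≤ N! / u ^ N` fails at `z = x`, where the inverse power takes the default
  -- value `0`; this is at most one point.
  have hfin : {z : L | (z : E) - x = 0}.Finite :=
    Set.Subsingleton.finite fun z hz z' hz' => Subtype.ext <| by
      rw [sub_eq_zero.1 hz, sub_eq_zero.1 hz']
  refine hfin.subset fun z hz => ?_
  by_contra hne
  refine hz ?_
  have hpos : 0 < ‖(z : E) - x‖ := norm_pos_iff.2 hne
  rw [Set.mem_ofPred_eq, Real.norm_of_nonneg (Real.exp_pos _).le, Real.exp_neg]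
  have h := Real.pow_div_factorial_le_exp (c * ‖(z : E) - x‖ ^ 2) (by positivity) N
  calc (Real.exp (c * ‖(z : E) - x‖ ^ 2))⁻¹
      ≤ ((c * ‖(z : E) - x‖ ^ 2) ^ N / N.factorial)⁻¹ := by gcongr
    _ = N.factorial / c ^ N * ‖(z : E) - x‖⁻¹ ^ (2 * N) := by
      rw [mul_pow, ← pow_mul, inv_pow]
      field_simp

lemma mem_span_basisFun_of_mem_lattice {x : V m} (hx : x ∈ lattice m) :
    x ∈ Submodule.span ℤ (Set.range (Pi.basisFun ℝ (Idx m))) := by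
  rw [Module.Basis.mem_span_iff_repr_mem]
  intro i
  obtain ⟨k, hk⟩ := hx i
  exact ⟨k, by simp [hk]⟩

lemma summable_thetaTerm (α : DiscGroup S) (τ : ℍ) (Z : TubeDomain S) :
    Summable fun l : cosetSet S α => thetaTerm τ Z.toGr (l : V m) := by
  obtain ⟨l₀, rfl⟩ := QuotientAddGroup.mk_surjective α
  obtain ⟨c, hc, hle⟩ := exists_le_majorant Z
  have hC : 0 < 2 * Real.pi * τ.im * c :=
    mul_pos (mul_pos (mul_pos two_pos Real.pi_pos) τ.im_pos) hc
  -- With `z = l - l₀` integral and the centre at `-l₀`, the Gaussian is evaluated at `l` itself.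
  have hsum := summable_exp_neg_mul_norm_sub_sq
    (Submodule.span ℤ (Set.range (Pi.basisFun ℝ (Idx m)))) hC (-(l₀ : V m))
  have hmem (l : cosetSet S (QuotientAddGroup.mk l₀)) :
      ((l : dualLattice S) : V m) - (l₀ : V m) ∈
        Submodule.span ℤ (Set.range (Pi.basisFun ℝ (Idx m))) := by
    apply mem_span_basisFun_of_mem_lattice
    have h := QuotientAddGroup.eq.1 (Eq.symm l.2)
    rw [AddSubgroup.mem_addSubgroupOf] at h
    simpa [neg_add_eq_sub] using h
  have hinj : Function.Injective fun l : cosetSet S (QuotientAddGroup.mk l₀) =>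
      (⟨_, hmem l⟩ : Submodule.span ℤ (Set.range (Pi.basisFun ℝ (Idx m)))) := by
    intro l l' h
    have := congrArg Subtype.val h
    exact Subtype.ext (Subtype.ext (sub_left_injective this))
  refine Summable.of_norm_bounded (hsum.comp_injective hinj) fun l => ?_
  rw [norm_thetaTerm]
  simp only [Function.comp_apply, sub_neg_eq_add, sub_add_cancel]
  refine Real.exp_le_exp.2 (neg_le_neg ?_)
  have h1 := hle ((l : dualLattice S) : V m)
  have h2 : 0 ≤ 2 * Real.pi * τ.im :=
    mul_nonneg (mul_nonneg zero_le_two Real.pi_pos.le) τ.im_pos.le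
  calc 2 * Real.pi * τ.im * c * ‖((l : dualLattice S) : V m)‖ ^ 2
      = 2 * Real.pi * τ.im * (c * ‖((l : dualLattice S) : V m)‖ ^ 2) := by ring
    _ ≤ _ := mul_le_mul_of_nonneg_left h1 h2

/-! ### The hyperbolic coordinates as a matrix of degree two -/

/-- The matrix with rows `(x₁, -x₂)` and `(x₃, x₄)`. -/
def hypMat (x : V m) : Matrix (Fin 2) (Fin 2) ℝ :=
  !![x (.inl 0), -x (.inl 1); x (.inr (.inr 0)), x (.inr (.inr 1))]

/-- The vector `x` with its hyperbolic coordinates replaced by those of a matrix. -/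
def withHyp (x : V m) (M : Matrix (Fin 2) (Fin 2) ℝ) : V m :=
  Sum.elim ![M 0 0, -M 0 1] (Sum.elim (fun i => x (.inr (.inl i))) ![M 1 0, M 1 1])

@[simp] lemma hypMat_withHyp (x : V m) (M : Matrix (Fin 2) (Fin 2) ℝ) :
    hypMat (withHyp x M) = M := by
  conv_rhs => rw [Matrix.eta_fin_two M]
  simp [hypMat, withHyp]

@[simp] lemma withHyp_withHyp (x : V m) (M N : Matrix (Fin 2) (Fin 2) ℝ) :
    withHyp (withHyp x M) N = withHyp x N := rfl

@[simp] lemma withHyp_hypMat (x : V m) : withHyp x (hypMat x) = x := by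
  funext i
  rcases i with i | i | i
  · fin_cases i <;> simp [withHyp, hypMat]
  · rfl
  · fin_cases i <;> simp [withHyp, hypMat]

/-- The minus sign in `hypMat` is chosen so that the hyperbolic part of `q` is a determinant, hence
multiplicative. -/
lemma q_withHyp (x : V m) (M : Matrix (Fin 2) (Fin 2) ℝ) :
    q S (withHyp x M) =
      M.det - sForm S (fun i => x (.inr (.inl i))) (fun i => x (.inr (.inl i))) / 2 := by
  rw [q, Q_apply, Matrix.det_fin_two]
  simp [withHyp]
  ring

lemma pairing_withHyp (Z : TubeDomain S) (x : V m) (M : Matrix (Fin 2) (Fin 2) ℝ) :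
    Z.pairing (withHyp x M) = M 0 0 - M 0 1 * (Z.z' : ℂ)
      - sFormC S (fun i => (x (.inr (.inl i)) : ℂ)) Z.w + M 1 0 * (Z.z : ℂ)
      - M 1 1 * ((Z.z : ℂ) * (Z.z' : ℂ) - sFormC S Z.w Z.w / 2) := by
  rw [pairing_eq]
  simp [withHyp]
  ring

/-- The value of `thetaTerm` after division of the hyperbolic coordinates by `√n`. -/
def scaledTerm (τ : ℍ) (Z : TubeDomain S) (n : ℕ) (x : V m) : ℂ :=
  thetaTerm τ Z.toGr (withHyp x ((Real.sqrt n)⁻¹ • hypMat x))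

/-- Left multiplication by `heckeMat t` on the hyperbolic coordinates. -/
def upMap (t : ℤ × ℤ × ℤ) (x : V m) : V m :=
  withHyp x ((heckeMat t).map (Int.cast : ℤ → ℝ) * hypMat x)

/-- Right multiplication by `heckeMatLower t` on the hyperbolic coordinates. -/
def downMap (t : ℤ × ℤ × ℤ) (x : V m) : V m :=
  withHyp x (hypMat x * (heckeMatLower t).map (Int.cast : ℤ → ℝ))

lemma scaleVec_eq_smul (n : ℕ) (d : ℤ) (w : Fin m → ℂ) :
    scaleVec n d w = ((Real.sqrt n : ℂ) / (d : ℂ)) • w := by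
  funext i
  simp [scaleVec]

lemma det_map_intCast (A : Matrix (Fin 2) (Fin 2) ℤ) :
    (A.map (Int.cast : ℤ → ℝ)).det = (A.det : ℝ) := by
  simp [Matrix.det_fin_two]

lemma det_inv_sqrt_smul (n : ℕ) (A : Matrix (Fin 2) (Fin 2) ℝ) :
    ((Real.sqrt n)⁻¹ • A).det = (n : ℝ)⁻¹ * A.det := by
  rw [Matrix.det_smul, Fintype.card_fin, inv_pow, Real.sq_sqrt (Nat.cast_nonneg n)]

/-- The factor `√n / d` has squared modulus `n / d² = a / d`, exactly the factor by which the height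
changes. -/
lemma normSq_div_height {n : ℕ} {a d : ℤ} (hd : 0 < d) (hn : a * d = n) {p p' : ℂ} {h h' : ℝ}
    (ha : 0 < a) (hp : p = (Real.sqrt n : ℂ) / (d : ℂ) * p') (hh : h = a / d * h') :
    Complex.normSq p / h = Complex.normSq p' / h' := by
  have hd' : (0 : ℝ) < d := by exact_mod_cast hd
  have ha' : (0 : ℝ) < a := by exact_mod_cast ha
  have hn' : (a : ℝ) * d = n := by exact_mod_cast hn
  have h1 : Complex.normSq ((Real.sqrt n : ℂ) / (d : ℂ)) = a / d := by
    rw [show (d : ℂ) = ((d : ℝ) : ℂ) by simp, ← Complex.ofReal_div, Complex.normSq_ofReal,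
      div_mul_div_comm, Real.mul_self_sqrt (Nat.cast_nonneg n), ← hn']
    field_simp
  rw [hp, hh, Complex.normSq_mul, h1, mul_div_mul_left _ _ (div_pos ha' hd').ne']

/-- Multiplying by a matrix of determinant `n` and dividing by `√n` preserves the determinant, hence
`q`. The pairing changes only by the factor `√n / d`, which the height absorbs. -/
lemma thetaTerm_up (τ : ℍ) (Z : TubeDomain S) {n : ℕ} (hn : 1 ≤ n) (t : ℤ × ℤ × ℤ)
    (ht : t ∈ heckeSet n) (x : V m) :
    thetaTerm τ (Z.up n t.1 t.2.1 t.2.2 ht).toGr x = scaledTerm τ Z n (upMap t x) := by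
  obtain ⟨a, b, d⟩ := t
  obtain ⟨⟨ha, hd⟩, had, -⟩ := mem_heckeSet.1 ht
  have hn0 : (n : ℝ) ≠ 0 := by positivity
  have hs : (Real.sqrt n : ℂ) * (Real.sqrt n : ℂ) = a * d := by
    rw [← Complex.ofReal_mul, Real.mul_self_sqrt (Nat.cast_nonneg n)]
    exact_mod_cast had.symm
  have hs0 : (Real.sqrt n : ℂ) ≠ 0 := by
    rw [Complex.ofReal_ne_zero, Real.sqrt_ne_zero (Nat.cast_nonneg n)]
    exact hn0
  have hd0 : (d : ℂ) ≠ 0 := by exact_mod_cast hd.ne'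
  rw [scaledTerm, upMap, withHyp_withHyp, hypMat_withHyp]
  refine thetaTerm_congr τ ?_ (normSq_div_height hd had ha ?_ ?_)
  · conv_lhs => rw [← withHyp_hypMat x]
    have had' : (a : ℝ) * d = n := by exact_mod_cast had
    rw [q_withHyp, q_withHyp, det_inv_sqrt_smul, Matrix.det_mul, det_map_intCast, det_heckeMat]
    push_cast
    rw [had', inv_mul_cancel_left₀ hn0]
  · conv_lhs => rw [← withHyp_hypMat x]
    rw [pairing_withHyp, pairing_withHyp]
    have e1 : (Z.up n a b d ht).w = ((Real.sqrt n : ℂ) / (d : ℂ)) • Z.w := scaleVec_eq_smul ..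
    have e2 : ((Z.up n a b d ht).z : ℂ) = ((a : ℂ) * (Z.z : ℂ) + (b : ℂ)) / (d : ℂ) := rfl
    have e3 : (Z.up n a b d ht).z' = Z.z' := rfl
    rw [e1, e2, e3]
    simp only [map_smul, LinearMap.smul_apply, smul_eq_mul, Matrix.smul_apply, Matrix.mul_apply,
      Fin.sum_univ_two, Matrix.map_apply, heckeMat, Matrix.of_apply, Matrix.cons_val_zero,
      Matrix.cons_val_one, Complex.ofReal_mul, Complex.ofReal_add, Complex.ofReal_inv,
      Complex.ofReal_intCast, Int.cast_zero, Complex.ofReal_zero]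
    -- The relation `s² = ad` is needed for the term with `S[w]`, where the scaling of `w` enters
    -- quadratically.
    generalize (Real.sqrt n : ℂ) = s at *
    field_simp
    linear_combination (hypMat x 1 1 * (sFormC S Z.w Z.w)) * hs
  · change 2 * (affinePoint Z.z a b d ha hd).im * Z.z'.im -
      sForm S (fun i => (scaleVec n d Z.w i).im) (fun i => (scaleVec n d Z.w i).im) = _
    rw [sForm_scaleVec n a d hd had, affinePoint_im, TubeDomain.height]
    ring

/-- The mirror image of `thetaTerm_up`: in the pairing `z` goes with the rows of the matrix and `z'`
with its columns, so the factor now stands on the right. -/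
lemma thetaTerm_down (τ : ℍ) (Z : TubeDomain S) {n : ℕ} (hn : 1 ≤ n) (t : ℤ × ℤ × ℤ)
    (ht : t ∈ heckeSet n) (x : V m) :
    thetaTerm τ (Z.down n t.1 t.2.1 t.2.2 ht).toGr x = scaledTerm τ Z n (downMap t x) := by
  obtain ⟨a, b, d⟩ := t
  obtain ⟨⟨ha, hd⟩, had, -⟩ := mem_heckeSet.1 ht
  have hn0 : (n : ℝ) ≠ 0 := by positivity
  have hs : (Real.sqrt n : ℂ) * (Real.sqrt n : ℂ) = a * d := by
    rw [← Complex.ofReal_mul, Real.mul_self_sqrt (Nat.cast_nonneg n)]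
    exact_mod_cast had.symm
  have hs0 : (Real.sqrt n : ℂ) ≠ 0 := by
    rw [Complex.ofReal_ne_zero, Real.sqrt_ne_zero (Nat.cast_nonneg n)]
    exact hn0
  have hd0 : (d : ℂ) ≠ 0 := by exact_mod_cast hd.ne'
  rw [scaledTerm, downMap, withHyp_withHyp, hypMat_withHyp]
  refine thetaTerm_congr τ ?_ (normSq_div_height hd had ha ?_ ?_)
  · conv_lhs => rw [← withHyp_hypMat x]
    have had' : (a : ℝ) * d = n := by exact_mod_cast had
    rw [q_withHyp, q_withHyp, det_inv_sqrt_smul, Matrix.det_mul, det_map_intCast,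
      det_heckeMatLower]
    push_cast
    rw [had', mul_comm _ (n : ℝ), inv_mul_cancel_left₀ hn0]
  · conv_lhs => rw [← withHyp_hypMat x]
    rw [pairing_withHyp, pairing_withHyp]
    have e1 : (Z.down n a b d ht).w = ((Real.sqrt n : ℂ) / (d : ℂ)) • Z.w := scaleVec_eq_smul ..
    have e2 : ((Z.down n a b d ht).z' : ℂ) = ((a : ℂ) * (Z.z' : ℂ) + (b : ℂ)) / (d : ℂ) := rfl
    have e3 : (Z.down n a b d ht).z = Z.z := rfl
    rw [e1, e2, e3]
    simp only [map_smul, LinearMap.smul_apply, smul_eq_mul, Matrix.smul_apply, Matrix.mul_apply,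
      Fin.sum_univ_two, Matrix.map_apply, heckeMatLower, Matrix.of_apply, Matrix.cons_val_zero,
      Matrix.cons_val_one, Complex.ofReal_mul, Complex.ofReal_add, Complex.ofReal_inv,
      Complex.ofReal_intCast, Int.cast_zero, Int.cast_neg, Complex.ofReal_neg,
      Complex.ofReal_zero]
    generalize (Real.sqrt n : ℂ) = s at *
    field_simp
    linear_combination (hypMat x 1 1 * (sFormC S Z.w Z.w)) * hs
  · change 2 * Z.z.im * (affinePoint Z.z' a b d ha hd).im -
      sForm S (fun i => (scaleVec n d Z.w i).im) (fun i => (scaleVec n d Z.w i).im) = _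
    rw [sForm_scaleVec n a d hd had, affinePoint_im, TubeDomain.height]
    ring

/-! ### The action on cosets of the lattice -/

lemma lattice_le_dualLattice : lattice m ≤ dualLattice S := by
  intro x hx i
  choose k hk using hx
  refine ⟨(matQ S *ᵥ k) i, ?_⟩
  simp [Matrix.mulVec, dotProduct, hk]

/-- The coset `α + L`, as a set of vectors of `V`. -/
def cosetVec (α : DiscGroup S) : Set (V m) := Subtype.val '' cosetSet S α

lemma mem_cosetVec_of_sub_mem {α : DiscGroup S} {x y : V m} (hx : x ∈ cosetVec α)
    (h : y - x ∈ lattice m) : y ∈ cosetVec α := by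
  obtain ⟨l, hl, rfl⟩ := hx
  have hy : y ∈ dualLattice S := by
    have := add_mem (lattice_le_dualLattice (S := S) h) l.2
    rwa [sub_add_cancel] at this
  refine ⟨⟨y, hy⟩, ?_, rfl⟩
  change (QuotientAddGroup.mk _ : DiscGroup S) = α
  rw [← hl, eq_comm, QuotientAddGroup.eq, AddSubgroup.mem_addSubgroupOf]
  simpa [neg_add_eq_sub] using h

lemma exists_hypMat_eq {α : DiscGroup S} {x : V m} (hx : x ∈ cosetVec α) :
    ∃ N : Matrix (Fin 2) (Fin 2) ℤ, hypMat x = N.map (Int.cast : ℤ → ℝ) := by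
  obtain ⟨⟨x, hx⟩, -, rfl⟩ := hx
  obtain ⟨k₀, h₀⟩ := hx (.inl 0)
  obtain ⟨k₁, h₁⟩ := hx (.inl 1)
  obtain ⟨k₂, h₂⟩ := hx (.inr (.inr 0))
  obtain ⟨k₃, h₃⟩ := hx (.inr (.inr 1))
  simp [matQ, Matrix.mulVec, dotProduct, Fin.sum_univ_two] at h₀ h₁ h₂ h₃
  -- The blocks `J` only permute the hyperbolic coordinates, so `Q x ∈ L` forces these to be
  -- integers; any denominators sit in the middle block.
  refine ⟨!![k₃, -k₂; k₁, k₀], ?_⟩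
  ext i j
  fin_cases i <;> fin_cases j <;> simp [hypMat, h₀, h₁, h₂, h₃]

/-- Old and new hyperbolic coordinates are both integral, so the change lies in `L`. This is why
every integral matrix occurs in the coset over a given middle block. -/
lemma withHyp_mem_cosetVec {α : DiscGroup S} {x : V m} (hx : x ∈ cosetVec α)
    (M : Matrix (Fin 2) (Fin 2) ℤ) : withHyp x (M.map (Int.cast : ℤ → ℝ)) ∈ cosetVec α := by
  obtain ⟨N, hN⟩ := exists_hypMat_eq hx
  refine mem_cosetVec_of_sub_mem hx fun i => ?_
  conv => enter [1, k]; rw [← withHyp_hypMat x, hN, withHyp_withHyp]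
  rcases i with i | i | i
  · fin_cases i
    · exact ⟨M 0 0 - N 0 0, by simp [withHyp]⟩
    · exact ⟨N 0 1 - M 0 1, by simp [withHyp]; ring⟩
  · exact ⟨0, by simp [withHyp]⟩
  · fin_cases i
    · exact ⟨M 1 0 - N 1 0, by simp [withHyp]⟩
    · exact ⟨M 1 1 - N 1 1, by simp [withHyp]⟩

lemma map_intCast_injective :
    Function.Injective fun A : Matrix (Fin 2) (Fin 2) ℤ => A.map (Int.cast : ℤ → ℝ) :=
  Matrix.map_injective Int.cast_injective

lemma map_intCast_mul (A B : Matrix (Fin 2) (Fin 2) ℤ) :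
    (A * B).map (Int.cast : ℤ → ℝ) = A.map (Int.cast : ℤ → ℝ) * B.map (Int.cast : ℤ → ℝ) :=
  Matrix.map_mul (f := Int.castRingHom ℝ)

/-- Turns the multiplicity of `y` in the rearranged sum into a count of left divisors of its matrix.
-/
lemma mem_upMap_image {α : DiscGroup S} {y : V m} {N : Matrix (Fin 2) (Fin 2) ℤ}
    (hy : y ∈ cosetVec α) (hN : hypMat y = N.map (Int.cast : ℤ → ℝ)) (t : ℤ × ℤ × ℤ) :
    y ∈ upMap t '' cosetVec α ↔ ∃ M, heckeMat t * M = N := by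
  constructor
  · rintro ⟨x, hx, rfl⟩
    obtain ⟨M, hM⟩ := exists_hypMat_eq hx
    refine ⟨M, map_intCast_injective ?_⟩
    simp only [map_intCast_mul, ← hN, ← hM, upMap, hypMat_withHyp]
  · rintro ⟨M, rfl⟩
    refine ⟨_, withHyp_mem_cosetVec hy M, ?_⟩
    rw [upMap, withHyp_withHyp, hypMat_withHyp, ← map_intCast_mul, ← hN, withHyp_hypMat]

lemma mem_downMap_image {α : DiscGroup S} {y : V m} {N : Matrix (Fin 2) (Fin 2) ℤ}
    (hy : y ∈ cosetVec α) (hN : hypMat y = N.map (Int.cast : ℤ → ℝ)) (t : ℤ × ℤ × ℤ) :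
    y ∈ downMap t '' cosetVec α ↔ ∃ M, M * heckeMatLower t = N := by
  constructor
  · rintro ⟨x, hx, rfl⟩
    obtain ⟨M, hM⟩ := exists_hypMat_eq hx
    refine ⟨M, map_intCast_injective ?_⟩
    simp only [map_intCast_mul, ← hN, ← hM, downMap, hypMat_withHyp]
  · rintro ⟨M, rfl⟩
    refine ⟨_, withHyp_mem_cosetVec hy M, ?_⟩
    rw [downMap, withHyp_withHyp, hypMat_withHyp, ← map_intCast_mul, ← hN, withHyp_hypMat]

lemma upMap_mem {α : DiscGroup S} {x : V m} (hx : x ∈ cosetVec α) (t : ℤ × ℤ × ℤ) :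
    upMap t x ∈ cosetVec α := by
  obtain ⟨M, hM⟩ := exists_hypMat_eq hx
  rw [upMap, hM, ← map_intCast_mul]
  exact withHyp_mem_cosetVec hx _

lemma downMap_mem {α : DiscGroup S} {x : V m} (hx : x ∈ cosetVec α) (t : ℤ × ℤ × ℤ) :
    downMap t x ∈ cosetVec α := by
  obtain ⟨M, hM⟩ := exists_hypMat_eq hx
  rw [downMap, hM, ← map_intCast_mul]
  exact withHyp_mem_cosetVec hx _

lemma isUnit_det_map {n : ℕ} {t : ℤ × ℤ × ℤ} (ht : t ∈ heckeSet n)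
    {A : Matrix (Fin 2) (Fin 2) ℤ} (hA : A.det = t.1 * t.2.2) :
    IsUnit (A.map (Int.cast : ℤ → ℝ)).det := by
  obtain ⟨a, b, d⟩ := t
  obtain ⟨⟨ha, hd⟩, -⟩ := mem_heckeSet.1 ht
  rw [det_map_intCast, hA, isUnit_iff_ne_zero]
  exact_mod_cast (mul_pos ha hd).ne'

lemma upMap_injective {n : ℕ} {t : ℤ × ℤ × ℤ} (ht : t ∈ heckeSet n) :
    Function.Injective (upMap t : V m → V m) := by
  have hdet := isUnit_det_map ht (det_heckeMat t)
  refine Function.LeftInverse.injective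
    (g := fun y => withHyp y (((heckeMat t).map (Int.cast : ℤ → ℝ))⁻¹ * hypMat y)) fun x => ?_
  simp only [upMap, withHyp_withHyp, hypMat_withHyp]
  rw [← Matrix.mul_assoc, Matrix.nonsing_inv_mul _ hdet, Matrix.one_mul, withHyp_hypMat]

lemma downMap_injective {n : ℕ} {t : ℤ × ℤ × ℤ} (ht : t ∈ heckeSet n) :
    Function.Injective (downMap t : V m → V m) := by
  have hdet := isUnit_det_map ht (det_heckeMatLower t)
  refine Function.LeftInverse.injective
    (g := fun y => withHyp y (hypMat y * ((heckeMatLower t).map (Int.cast : ℤ → ℝ))⁻¹))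
    fun x => ?_
  simp only [downMap, withHyp_withHyp, hypMat_withHyp]
  rw [Matrix.mul_assoc, Matrix.mul_nonsing_inv _ hdet, Matrix.mul_one, withHyp_hypMat]

/-! ### Rearrangement of the sums -/

open Classical in
/-- A finite sum of series along injective maps counts every point with its multiplicity. -/
lemma sum_tsum_comp_eq {ι X : Type*} (s : Finset ι) (C : Set X) (T : ι → X → X)
    (hT : ∀ t ∈ s, Function.Injective (T t)) (G : X → ℂ)
    (hG : ∀ t ∈ s, Summable fun x : C => G (T t x)) :
    ∑ t ∈ s, ∑' x : C, G (T t x) = ∑' y, ((s.filter fun t => y ∈ T t '' C).card : ℂ) * G y := by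
  -- By injectivity each series is the sum of `G` over the image; as indicator series over `X` they
  -- can be added termwise.
  have h1 : ∀ t ∈ s, HasSum ((T t '' C).indicator G) (∑' x : C, G (T t x)) := by
    intro t ht
    rw [← hasSum_subtype_iff_indicator]
    have h := (hG t ht).hasSum
    exact (Equiv.Set.image (T t) C (hT t ht)).hasSum_iff.1 h
  rw [← (hasSum_sum h1).tsum_eq]
  refine tsum_congr fun y => ?_
  simp only [Set.indicator_apply]
  rw [Finset.sum_ite, Finset.sum_const_zero, add_zero, Finset.sum_const, nsmul_eq_mul]

lemma tsum_cosetSet (α : DiscGroup S) (f : V m → ℂ) :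
    ∑' l : cosetSet S α, f (l : V m) = ∑' x : cosetVec α, f x :=
  (Equiv.tsum_eq (Equiv.Set.image _ (cosetSet S α) Subtype.val_injective)
    fun x : cosetVec α => f x)

lemma summable_cosetVec {α : DiscGroup S} {f : V m → ℂ}
    (h : Summable fun l : cosetSet S α => f (l : V m)) :
    Summable fun x : cosetVec α => f x :=
  (Equiv.summable_iff (Equiv.Set.image _ (cosetSet S α) Subtype.val_injective)
    (f := fun x : cosetVec α => f x)).1 h

open Classical in
-- Inside the coset this is the equality of left and right divisor counts; outside it both counts
-- are zero, since both maps preserve the coset.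
lemma card_upMap_eq_card_downMap {n : ℕ} (hn : 1 ≤ n) (α : DiscGroup S) (y : V m) :
    ((heckeSet n).filter fun t => y ∈ upMap t '' cosetVec α).card =
      ((heckeSet n).filter fun t => y ∈ downMap t '' cosetVec α).card := by
  by_cases hy : y ∈ cosetVec α
  · obtain ⟨N, hN⟩ := exists_hypMat_eq hy
    simp only [mem_upMap_image hy hN, mem_downMap_image hy hN]
    exact card_filter_heckeMatLower hn N
  · rw [Finset.filter_false_of_mem, Finset.filter_false_of_mem]
    · rintro t - ⟨x, hx, rfl⟩
      exact hy (downMap_mem hx t)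
    · rintro t - ⟨x, hx, rfl⟩
      exact hy (upMap_mem hx t)

/-- The Siegel theta function satisfies the additive symmetry. -/
lemma sum_thetaTube_up_eq_sum_thetaTube_down (α : DiscGroup S) (τ : ℍ) {n : ℕ} (hn : 1 ≤ n)
    (Z : TubeDomain S) :
    ∑ t : heckeSet n, thetaTube α τ (Z.up n t.1.1 t.1.2.1 t.1.2.2 t.2) =
      ∑ t : heckeSet n, thetaTube α τ (Z.down n t.1.1 t.1.2.1 t.1.2.2 t.2) := by
  have hup (t : ℤ × ℤ × ℤ) (ht : t ∈ heckeSet n) : thetaTube α τ (Z.up n t.1 t.2.1 t.2.2 ht) =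
      ∑' x : cosetVec α, scaledTerm τ Z n (upMap t x) := by
    rw [thetaTube, theta, tsum_cosetSet]
    exact tsum_congr fun x => thetaTerm_up τ Z hn t ht x
  have hdown (t : ℤ × ℤ × ℤ) (ht : t ∈ heckeSet n) :
      thetaTube α τ (Z.down n t.1 t.2.1 t.2.2 ht) =
        ∑' x : cosetVec α, scaledTerm τ Z n (downMap t x) := by
    rw [thetaTube, theta, tsum_cosetSet]
    exact tsum_congr fun x => thetaTerm_down τ Z hn t ht x
  have hmid : ∑ t ∈ heckeSet n, ∑' x : cosetVec α, scaledTerm τ Z n (upMap t x) =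
      ∑ t ∈ heckeSet n, ∑' x : cosetVec α, scaledTerm τ Z n (downMap t x) := by
    rw [sum_tsum_comp_eq (heckeSet n) (cosetVec α) upMap (fun t ht => upMap_injective ht)
        (scaledTerm τ Z n) fun t ht => ?_,
      sum_tsum_comp_eq (heckeSet n) (cosetVec α) downMap (fun t ht => downMap_injective ht)
        (scaledTerm τ Z n) fun t ht => ?_]
    · exact tsum_congr fun y => by rw [card_upMap_eq_card_downMap hn]
    · simp only [← thetaTerm_down τ Z hn t ht]
      exact summable_cosetVec (summable_thetaTerm α τ (Z.down n t.1 t.2.1 t.2.2 ht))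
    · simp only [← thetaTerm_up τ Z hn t ht]
      exact summable_cosetVec (summable_thetaTerm α τ (Z.up n t.1 t.2.1 t.2.2 ht))
  rw [← Finset.sum_coe_sort, ← Finset.sum_coe_sort (heckeSet n)] at hmid
  refine (Finset.sum_congr rfl fun t _ => hup t.1 t.2).trans (hmid.trans ?_)
  exact Finset.sum_congr rfl fun t _ => (hdown t.1 t.2).symm

end SiegelTheta

end

open SiegelTheta in
theorem theorem3p1 {m : ℕ} (S : EvenPosDefMatrix m) (α : DiscGroup S) (τ : ℍ) :
    (∀ Z : TubeDomain S, Summable fun l : cosetSet S α => thetaTerm τ Z.toGr (l : V m)) ∧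
    ∀ n : ℕ, 1 ≤ n → ∀ Z : TubeDomain S,
      ∑ t : heckeSet n, thetaTube α τ (Z.up n t.1.1 t.1.2.1 t.1.2.2 t.2) =
        ∑ t : heckeSet n, thetaTube α τ (Z.down n t.1.1 t.1.2.1 t.1.2.2 t.2) :=
  ⟨summable_thetaTerm α τ, fun _ hn Z => sum_thetaTube_up_eq_sum_thetaTube_down α τ hn Z⟩
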